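/- Let $n$ be a nonnegative integer and let $\mathcal{H}^1$ denote the one-dimensional Hausdorff measure on $\mathbb{R}^n$ (with the Euclidean distance), normalized so that it equals length on line segments. For $x,y,z\in\mathbb{R}^n$ let $c(x,y,z)$ be the inverse of the radius of the circumcircle of the triangle $(x,y,z)$, with $c(x,y,z)=0$ if $x,y,z$ are collinear (in particular, if two of them coincide), and for a Borel set $A\subset\mathbb{R}^n$ put $$c^2(A)=\int_A\int_A\int_A c(x,y,z)^2\,d\mathcal{H}^1(x)\,d\mathcal{H}^1(y)\,d\mathcal{H}^1(z)\in[0,\infty].$$ **Proposition 1.1.** Let $E\subset\mathbb{R}^n$ be a Borel set with $0<\mathcal{H}^1(E)<\infty$ and $c^2(E)<\infty$. Then for every $\eta>0$ there exists a subset $F$ of $E$ such that 1. $F$ is compact; 2. $c^2(F)\le \eta\,\operatorname{diam}F$; 3. $\mathcal{H}^1(F)>\dfrac{\operatorname{diam}F}{40}$; 4. $\mathcal{H}^1(F\cap B(x,t))\le 3t$ for all $x\in F$ and all $t>0$, where $B(x,t)$ is the closed ball with center $x$ and radius $t$. -/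

import Mathlib

open MeasureTheory
open scoped ENNReal

noncomputable section

open Classical in
/-- The Menger curvature `c(x, y, z)` of three points of `ℝⁿ`: the inverse of the radius of the
circumcircle of the triangle `(x, y, z)`. For a degenerate triple (collinear points, the case of
two equal points included) it is `0`. -/
def mengerCurvature {n : ℕ} (x y z : EuclideanSpace ℝ (Fin n)) : ℝ :=
  if h : AffineIndependent ℝ ![x, y, z] then
    (Affine.Simplex.circumradius (⟨![x, y, z], h⟩ : Affine.Triangle ℝ (EuclideanSpace ℝ (Fin n))))⁻¹
  else 0

/-- `c²(E) = ∫∫∫_{E³} c(x, y, z)² dℋ¹(x) dℋ¹(y) dℋ¹(z)`, the square of the total Menger curvature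
of `E`, as an extended nonnegative number; `ℋ¹ = μH[1]` is the one-dimensional Hausdorff measure
on `ℝⁿ` with its Euclidean distance. -/
def totalMengerCurvatureSq {n : ℕ} (E : Set (EuclideanSpace ℝ (Fin n))) : ℝ≥0∞ :=
  ∫⁻ x in E, ∫⁻ y in E, ∫⁻ z in E,
    ENNReal.ofReal (mengerCurvature x y z ^ 2)
      ∂(Measure.hausdorffMeasure 1) ∂(Measure.hausdorffMeasure 1) ∂(Measure.hausdorffMeasure 1)

/-- A 1-set: a Borel set `E ⊆ ℝⁿ` with `0 < ℋ¹(E) < ∞`. -/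
structure IsOneSet {n : ℕ} (E : Set (EuclideanSpace ℝ (Fin n))) : Prop where
  measurableSet : MeasurableSet E
  hausdorffMeasure_pos : 0 < Measure.hausdorffMeasure 1 E
  hausdorffMeasure_lt_top : Measure.hausdorffMeasure 1 E < ∞

end

/-! Almost every `x ∈ E` satisfies `ℋ¹(E ∩ B(x,t)) ≤ 3t` at small scales, by a covering argument,
and has small curvature integral over `y` near `x`, by absolute continuity. Countably many scales
exhaust these points, so for some `δ` both bounds hold below scale `δ` on a set `A ⊆ E` of positive
measure. Comparison of `ℋ¹` with covers gives a compact `F ⊆ A` with `diam F < δ` and `ℋ¹(F) > diam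
F / 2`. As `F ⊆ B(x, diam F)` for each `x ∈ F`, the growth bound gives `ℋ¹(F) ≤ 3 diam F`, and
integrating the curvature bound over `F` gives `c²(F) ≤ (η/3) ℋ¹(F) ≤ η diam F`. -/

open Classical in
/-- The law of sines as a formula for the Menger curvature of three points. -/
theorem mengerCurvature_eq_ite {n : ℕ} (x y z : EuclideanSpace ℝ (Fin n)) :
    mengerCurvature x y z =
      if x = y ∨ z = y then 0 else 2 * Real.sin (EuclideanGeometry.angle x y z) / dist x z := by
  unfold mengerCurvature
  by_cases h : AffineIndependent ℝ ![x, y, z]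
  · have hnc := (affineIndependent_iff_not_collinear_set (k := ℝ)).1 h
    rw [EuclideanGeometry.collinear_iff_eq_or_eq_or_angle_eq_zero_or_angle_eq_pi] at hnc
    rw [dif_pos h, if_neg (fun hh => hnc (hh.imp_right Or.inl))]
    have hs := Affine.Triangle.dist_div_sin_angle_eq_two_mul_circumradius
      (⟨![x, y, z], h⟩ : Affine.Triangle ℝ (EuclideanSpace ℝ (Fin n)))
      (i₁ := 0) (i₂ := 1) (i₃ := 2) (by decide) (by decide) (by decide)
    simp only [Matrix.cons_val] at hs
    rw [mul_div_assoc, ← inv_div (dist x z), hs, mul_inv, mul_inv_cancel_left₀ two_ne_zero]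
  · have hc := (not_iff_comm.1 (affineIndependent_iff_not_collinear_set (k := ℝ)).symm).1 h
    rw [EuclideanGeometry.collinear_iff_eq_or_eq_or_angle_eq_zero_or_angle_eq_pi,
      ← or_assoc] at hc
    rw [dif_neg h]
    split_ifs with hd
    · rfl
    · rcases hc.resolve_left hd with h0 | h0 <;> simp [h0]

theorem measurable_mengerCurvature {n : ℕ} :
    Measurable fun p : EuclideanSpace ℝ (Fin n) × EuclideanSpace ℝ (Fin n) ×
      EuclideanSpace ℝ (Fin n) => mengerCurvature p.1 p.2.1 p.2.2 := by
  classical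
  simp only [mengerCurvature_eq_ite]
  refine Measurable.ite ?_ measurable_const ?_
  · exact (measurableSet_eq_fun (by fun_prop) (by fun_prop)).union
      (measurableSet_eq_fun (by fun_prop) (by fun_prop))
  · simp only [EuclideanGeometry.angle, InnerProductGeometry.angle, vsub_eq_sub]
    fun_prop

open Metric Set Filter Topology

/-- The part of a set of finite `ℋ¹`-measure where the upper density exceeds `3 / 2` at
arbitrarily small scales is negligible. -/
theorem hausdorffMeasure_setOf_frequently_lt_closedBall {n : ℕ}
    {E : Set (EuclideanSpace ℝ (Fin n))} (hE : MeasurableSet E)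
    (hfin : Measure.hausdorffMeasure 1 E < ∞) :
    Measure.hausdorffMeasure 1 {x ∈ E | ∀ δ > (0 : ℝ), ∃ t ∈ Ioo 0 δ,
      ENNReal.ofReal (3 * t) < Measure.hausdorffMeasure 1 (E ∩ closedBall x t)} = 0 := by
  set A := {x ∈ E | ∀ δ > (0 : ℝ), ∃ t ∈ Ioo 0 δ,
      ENNReal.ofReal (3 * t) < Measure.hausdorffMeasure 1 (E ∩ closedBall x t)} with hA
  have hAE : A ⊆ E := fun x hx => hx.1
  set μ := (Measure.hausdorffMeasure 1 : Measure (EuclideanSpace ℝ (Fin n))).restrict E with hμ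
  have : IsFiniteMeasure μ := ⟨by rwa [hμ, Measure.restrict_apply_univ]⟩
  have hμA : ∀ s, μ s = Measure.hausdorffMeasure 1 (E ∩ s) := fun s => by
    rw [hμ, Measure.restrict_apply' hE, inter_comm]
  have hAeq : μ A = Measure.hausdorffMeasure 1 A := by rw [hμA, inter_eq_right.2 hAE]
  -- Disjoint balls in `V` with `3r < μ(ball)` cover almost all of `A`. Their diameters are at most
  -- `2r`, hence sum to at most `2/3 * μ V`.
  have key : ∀ V, IsOpen V → A ⊆ V → 3 * μ A ≤ 2 * μ V := by
    intro V hV hAV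
    have hex : ∀ k : ℕ, ∃ (t : Set (EuclideanSpace ℝ (Fin n))) (r : EuclideanSpace ℝ (Fin n) → ℝ),
        t.Countable ∧ t ⊆ A ∧
        (∀ x ∈ t, r x ∈ {s : ℝ | ENNReal.ofReal (3 * s) < μ (closedBall x s) ∧
          closedBall x s ⊆ V} ∩ Ioo 0 (1 / ((k : ℝ) + 1))) ∧
        μ (A \ ⋃ x ∈ t, closedBall x (r x)) = 0 ∧
        t.PairwiseDisjoint fun x => closedBall x (r x) := by
      intro k
      refine Besicovitch.exists_disjoint_closedBall_covering_ae μ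
        (fun x => {s : ℝ | ENNReal.ofReal (3 * s) < μ (closedBall x s) ∧ closedBall x s ⊆ V}) A
        (fun x hx δ hδ => ?_) (fun _ => 1 / ((k : ℝ) + 1)) (fun _ _ => by positivity)
      obtain ⟨ε, hε, hεV⟩ := nhds_basis_closedBall.mem_iff.1 (hV.mem_nhds (hAV hx))
      obtain ⟨t, ht, hlt⟩ := hx.2 (min δ ε) (lt_min hδ hε)
      refine ⟨t, ⟨by rwa [hμA], ?_⟩, ht.1, ht.2.trans_le (min_le_left _ _)⟩
      exact (closedBall_subset_closedBall (ht.2.le.trans (min_le_right _ _))).trans hεV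
    choose t r htc htA hr hcov hdisj using hex
    -- Each cover may miss a null set; `B` keeps the points covered at every scale.
    set B := A ∩ ⋂ k, ⋃ x ∈ t k, closedBall x (r k x) with hB
    have hAB : μ A ≤ μ B := by
      have h0 : μ (⋃ k, A \ ⋃ x ∈ t k, closedBall x (r k x)) = 0 := measure_iUnion_null hcov
      calc μ A ≤ μ (B ∪ ⋃ k, A \ ⋃ x ∈ t k, closedBall x (r k x)) := by
            refine measure_mono fun x hx => ?_
            by_cases hxB : x ∈ ⋂ k, ⋃ x ∈ t k, closedBall x (r k x)
            · exact Or.inl ⟨hx, hxB⟩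
            · obtain ⟨k, hk⟩ := not_forall.1 (mt mem_iInter.2 hxB)
              exact Or.inr (mem_iUnion.2 ⟨k, hx, hk⟩)
        _ ≤ μ B + 0 := h0 ▸ measure_union_le _ _
        _ = μ B := add_zero _
    have hBle : μ B ≤ 2 / 3 * μ V := by
      have (k : ℕ) : Countable (t k) := htc k
      rw [hμA]
      refine (measure_mono inter_subset_right).trans ?_
      have hlim : Tendsto (fun k : ℕ => 2 * ENNReal.ofReal (1 / ((k : ℝ) + 1))) atTop (𝓝 0) := by
        have := ENNReal.Tendsto.const_mul (a := 2)
          (ENNReal.tendsto_ofReal tendsto_one_div_add_atTop_nhds_zero_nat) (Or.inr (by simp))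
        simpa using this
      refine (Measure.hausdorffMeasure_le_liminf_tsum (ι := fun k : ℕ => t k) 1 B _ hlim
        (fun k x => closedBall (x : EuclideanSpace ℝ (Fin n)) (r k x)) ?_ ?_).trans ?_
      · refine Eventually.of_forall fun k x => ?_
        rw [← closedEBall_ofReal (hr k x x.2).2.1.le]
        refine ediam_closedEBall_le.trans ?_
        gcongr
        exact (hr k x x.2).2.2.le
      · refine Eventually.of_forall fun k x hx => ?_
        have := mem_iInter.1 hx.2 k
        simpa using this
      · refine (liminf_le_liminf (v := fun _ => 2 / 3 * μ V)
          (Eventually.of_forall fun k => ?_)).trans (liminf_const _).le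
        calc ∑' x : t k, ediam (closedBall (x : EuclideanSpace ℝ (Fin n)) (r k x)) ^ (1 : ℝ)
            ≤ ∑' x : t k, 2 / 3 * μ (closedBall (x : EuclideanSpace ℝ (Fin n)) (r k x)) := by
              refine ENNReal.tsum_le_tsum fun x => ?_
              rw [ENNReal.rpow_one, ← closedEBall_ofReal (hr k x x.2).2.1.le]
              refine ediam_closedEBall_le.trans ?_
              rw [closedEBall_ofReal (hr k x x.2).2.1.le]
              have h3 := (hr k x x.2).1.1.le
              rw [ENNReal.ofReal_mul (by norm_num), ENNReal.ofReal_ofNat] at h3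
              calc 2 * ENNReal.ofReal (r k x)
                  = 2 / 3 * (3 * ENNReal.ofReal (r k x)) := by
                    rw [← mul_assoc, ENNReal.div_mul_cancel (by simp) (by simp)]
                _ ≤ _ := by gcongr
          _ = 2 / 3 * μ (⋃ x ∈ t k, closedBall x (r k x)) := by
              rw [ENNReal.tsum_mul_left, measure_biUnion (htc k) (hdisj k)
                fun _ _ => measurableSet_closedBall]
          _ ≤ 2 / 3 * μ V := by
              gcongr
              exact iUnion₂_subset fun x hx => (hr k x hx).1.2
    calc 3 * μ A ≤ 3 * (2 / 3 * μ V) := by gcongr; exact hAB.trans hBle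
      _ = 2 * μ V := by
        rw [← mul_assoc, ENNReal.mul_div_cancel (by simp) (by simp)]
  rw [← hAeq]
  by_contra hne
  have hlt : μ A < 3 / 2 * μ A := by
    have h1 : (1 : ℝ≥0∞) < 3 / 2 := by
      rw [ENNReal.lt_div_iff_mul_lt (by simp) (by simp)]
      norm_num
    simpa using ENNReal.mul_lt_mul_left hne (measure_ne_top μ A) h1
  obtain ⟨V, hAV, hV, hVlt⟩ := A.exists_isOpen_lt_of_lt _ hlt
  have h1 := key V hV hAV
  have h2 : 2 * μ V < 2 * (3 / 2 * μ A) := by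
    gcongr
    simp
  rw [← mul_assoc, ENNReal.mul_div_cancel (by simp) (by simp)] at h2
  exact absurd h2 h1.not_gt

/-- Inside a set of positive finite `ℋ¹`-measure there are arbitrarily small pieces whose
measure is at least half of the diameter of the set that cuts them out. -/
theorem exists_ediam_lt_two_mul_hausdorffMeasure_inter {X : Type*} [MetricSpace X]
    [MeasurableSpace X] [BorelSpace X] {A : Set X} (hA : MeasurableSet A)
    (h0 : Measure.hausdorffMeasure 1 A ≠ 0) (hfin : Measure.hausdorffMeasure 1 A ≠ ∞)
    {δ : ℝ≥0∞} (hδ : 0 < δ) :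
    ∃ U : Set X, ediam U ≤ δ ∧ ediam U < 2 * Measure.hausdorffMeasure 1 (A ∩ U) := by
  by_contra! hcon
  -- `ℋ¹` dominates every measure bounded by the diameter on small sets; here that would give `2
  -- ℋ¹(A) ≤ ℋ¹(A)`.
  have hle := Measure.le_hausdorffMeasure 1
    ((2 : ℝ≥0∞) • (Measure.hausdorffMeasure 1 : Measure X).restrict A) δ hδ fun s hs => by
      rw [Measure.smul_apply, Measure.restrict_apply' hA, smul_eq_mul, inter_comm,
        ENNReal.rpow_one]
      exact hcon s hs
  have h2 := hle A
  rw [Measure.smul_apply, Measure.restrict_apply_self, smul_eq_mul, two_mul] at h2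
  exact (ENNReal.lt_add_right hfin h0).not_ge h2

theorem measurable_lintegral_mengerCurvature_sq {n : ℕ}
    (μ : Measure (EuclideanSpace ℝ (Fin n))) [SFinite μ] :
    Measurable fun p : EuclideanSpace ℝ (Fin n) × EuclideanSpace ℝ (Fin n) =>
      ∫⁻ z, ENNReal.ofReal (mengerCurvature p.1 p.2 z ^ 2) ∂μ := by
  refine Measurable.lintegral_prod_right' (f := fun p : (EuclideanSpace ℝ (Fin n) ×
    EuclideanSpace ℝ (Fin n)) × EuclideanSpace ℝ (Fin n) =>
      ENNReal.ofReal (mengerCurvature p.1.1 p.1.2 p.2 ^ 2)) ?_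
  exact ((measurable_mengerCurvature.comp MeasurableEquiv.prodAssoc.measurable).pow_const
    2).ennreal_ofReal

/-- The curvature seen from a point `x` of a set of finite total curvature, with one further point
restricted to a small ball around `x`, tends to `0` with the radius for almost every `x`. -/
theorem ae_tendsto_setLIntegral_closedBall_mengerCurvature {n : ℕ}
    {E : Set (EuclideanSpace ℝ (Fin n))} (hfin : Measure.hausdorffMeasure 1 E < ∞)
    (hc : totalMengerCurvatureSq E < ∞) :
    ∀ᵐ x ∂(Measure.hausdorffMeasure 1 : Measure (EuclideanSpace ℝ (Fin n))).restrict E,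
      Tendsto (fun k : ℕ => ∫⁻ y in closedBall x (1 / ((k : ℝ) + 1)),
        ∫⁻ z, ENNReal.ofReal (mengerCurvature x y z ^ 2)
          ∂(Measure.hausdorffMeasure 1).restrict E ∂(Measure.hausdorffMeasure 1).restrict E)
        atTop (𝓝 0) := by
  set μ := (Measure.hausdorffMeasure 1 : Measure (EuclideanSpace ℝ (Fin n))).restrict E with hμ
  have : IsFiniteMeasure μ := ⟨by rwa [hμ, Measure.restrict_apply_univ]⟩
  have : NullSingletonClass μ := by
    have := Measure.nullSingletonClass_hausdorff (EuclideanSpace ℝ (Fin n)) one_pos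
    rw [hμ]
    infer_instance
  have hm : Measurable fun x => ∫⁻ y, ∫⁻ z, ENNReal.ofReal (mengerCurvature x y z ^ 2) ∂μ ∂μ :=
    Measurable.lintegral_prod_right' (measurable_lintegral_mengerCurvature_sq μ)
  filter_upwards [ae_lt_top hm hc.ne] with x hx
  refine tendsto_setLIntegral_zero hx.ne ?_
  have hlim := tendsto_measure_iInter_atTop (μ := μ)
    (s := fun k : ℕ => closedBall x (1 / ((k : ℝ) + 1)))
    (fun _ => measurableSet_closedBall.nullMeasurableSet)
    (fun i j hij => closedBall_subset_closedBall (Nat.one_div_le_one_div hij))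
    ⟨0, measure_ne_top _ _⟩
  have hI : ⋂ k : ℕ, closedBall x (1 / ((k : ℝ) + 1)) = {x} := by
    refine subset_antisymm (fun y hy => ?_) (fun y hy => ?_)
    · refine dist_le_zero.1 (ge_of_tendsto' tendsto_one_div_add_atTop_nhds_zero_nat
        fun k => mem_iInter.1 hy k)
    · rw [mem_singleton_iff.1 hy]
      exact mem_iInter.2 fun k => mem_closedBall_self (by positivity)
  rwa [hI, measure_singleton] at hlim

theorem measurable_setLIntegral_closedBall_mengerCurvature {n : ℕ}
    (μ : Measure (EuclideanSpace ℝ (Fin n))) [SFinite μ] (δ : ℝ) :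
    Measurable fun x => ∫⁻ y in closedBall x δ,
      ∫⁻ z, ENNReal.ofReal (mengerCurvature x y z ^ 2) ∂μ ∂μ := by
  have h2 : MeasurableSet {p : EuclideanSpace ℝ (Fin n) × EuclideanSpace ℝ (Fin n) |
      dist p.2 p.1 ≤ δ} := measurableSet_le (by fun_prop) measurable_const
  have h3 := Measurable.lintegral_prod_right' (ν := μ) ((measurable_lintegral_mengerCurvature_sq μ).indicator h2)
  convert h3 using 2 with x
  rw [← lintegral_indicator measurableSet_closedBall]
  rfl

/-- The set of points around which `s` has linear growth with a given constant, up to a given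
scale, is closed. -/
theorem isClosed_setOf_forall_measure_inter_closedBall_le {X : Type*} [PseudoMetricSpace X]
    {m : MeasurableSpace X} (μ : Measure X) (s : Set X) (C δ : ℝ) :
    IsClosed {x | ∀ t ∈ Ioo 0 δ, μ (s ∩ closedBall x t) ≤ ENNReal.ofReal (C * t)} := by
  -- For `u j → x`, the ball `B(x,t)` lies in `B(u j, t + dist (u j) x)`, whose radius tends to `t`
  -- and is eventually below `δ`.
  refine isClosed_of_closure_subset fun x hx t ht => ?_
  obtain ⟨u, hu, hux⟩ := mem_closure_iff_seq_limit.1 hx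
  have hd : Tendsto (fun j => t + dist (u j) x) atTop (𝓝 t) := by
    simpa using (tendsto_iff_dist_tendsto_zero.1 hux).const_add t
  refine ge_of_tendsto (ENNReal.tendsto_ofReal (hd.const_mul C)) ?_
  filter_upwards [hd.eventually (gt_mem_nhds ht.2)] with j hj
  refine (measure_mono (inter_subset_inter_right _ ?_)).trans
    (hu j _ ⟨add_pos_of_pos_of_nonneg ht.1 dist_nonneg, hj⟩)
  exact closedBall_subset_closedBall' (by rw [dist_comm])

theorem proposition1p1 (n : ℕ) (E : Set (EuclideanSpace ℝ (Fin n)))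
    (hE : IsOneSet E) (hc : totalMengerCurvatureSq E < ∞) (η : ℝ) (hη : 0 < η) :
    ∃ F : Set (EuclideanSpace ℝ (Fin n)), F ⊆ E ∧
      IsCompact F ∧
      totalMengerCurvatureSq F ≤ ENNReal.ofReal (η * Metric.diam F) ∧
      ENNReal.ofReal (Metric.diam F / 40) < Measure.hausdorffMeasure 1 F ∧
      ∀ x ∈ F, ∀ t : ℝ, 0 < t →
        Measure.hausdorffMeasure 1 (F ∩ Metric.closedBall x t) ≤ ENNReal.ofReal (3 * t) := by
  obtain ⟨hEm, hEpos, hEfin⟩ := hE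
  set μ := (Measure.hausdorffMeasure 1 : Measure (EuclideanSpace ℝ (Fin n))).restrict E with hμ
  have : IsFiniteMeasure μ := ⟨by rwa [hμ, Measure.restrict_apply_univ]⟩
  have hμE : ∀ s ⊆ E, μ s = Measure.hausdorffMeasure 1 s := fun s hs => by
    rw [hμ, Measure.restrict_apply' hEm, inter_eq_left.2 hs]
  set G : ℕ → Set (EuclideanSpace ℝ (Fin n)) := fun k =>
    {x | ∫⁻ y in closedBall x (1 / ((k : ℝ) + 1)),
      ∫⁻ z, ENNReal.ofReal (mengerCurvature x y z ^ 2) ∂μ ∂μ ≤ ENNReal.ofReal (η / 3)} with hG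
  set D : ℕ → Set (EuclideanSpace ℝ (Fin n)) := fun k =>
    {x | ∀ t ∈ Ioo 0 (1 / ((k : ℝ) + 1)), Measure.hausdorffMeasure 1 (E ∩ closedBall x t) ≤
      ENNReal.ofReal (3 * t)} with hD
  have hae : ∀ᵐ x ∂μ, x ∈ ⋃ k, E ∩ (G k ∩ D k) := by
    have hdens : ∀ᵐ x ∂μ, ¬ (x ∈ E ∧ ∀ δ > (0 : ℝ), ∃ t ∈ Ioo 0 δ,
        ENNReal.ofReal (3 * t) < Measure.hausdorffMeasure 1 (E ∩ closedBall x t)) :=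
      ae_restrict_of_ae (measure_eq_zero_iff_ae_notMem.1
        (hausdorffMeasure_setOf_frequently_lt_closedBall hEm hEfin))
    filter_upwards [hdens, ae_tendsto_setLIntegral_closedBall_mengerCurvature hEfin hc,
      ae_restrict_mem hEm] with x hx hxt hxE
    push Not at hx
    obtain ⟨δ, hδ, hxδ⟩ := hx hxE
    have hη3 : 0 < ENNReal.ofReal (η / 3) := ENNReal.ofReal_pos.2 (by positivity)
    obtain ⟨k, hk1, hk2⟩ := ((hxt.eventually (gt_mem_nhds hη3)).and
      (tendsto_one_div_add_atTop_nhds_zero_nat.eventually (gt_mem_nhds hδ))).exists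
    exact mem_iUnion.2 ⟨k, hxE, hk1.le, fun t ht => hxδ t ⟨ht.1, ht.2.trans hk2⟩⟩
  obtain ⟨k, hk⟩ : ∃ k, 0 < μ (E ∩ (G k ∩ D k)) := by
    refine exists_measure_pos_of_not_measure_iUnion_null fun h0 => hEpos.ne' ?_
    rw [← hμE E subset_rfl]
    refine measure_mono_null_ae ?_ h0
    filter_upwards [hae] with x hx _ using hx
  set A := E ∩ (G k ∩ D k) with hA
  have hAE : A ⊆ E := inter_subset_left
  have hAm : MeasurableSet A := hEm.inter
    ((measurableSet_le (measurable_setLIntegral_closedBall_mengerCurvature μ _)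
      measurable_const).inter
      (isClosed_setOf_forall_measure_inter_closedBall_le _ _ _ _).measurableSet)
  rw [hμE A hAE] at hk
  set δ : ℝ := 1 / ((k : ℝ) + 1) with hδ
  have hδ0 : 0 < δ := by positivity
  -- Scale `δ / 2` makes `diam F < δ` strict, so the growth bound applies at radius `diam F`.
  obtain ⟨U, hUδ, hU⟩ := exists_ediam_lt_two_mul_hausdorffMeasure_inter hAm hk.ne'
    ((measure_mono hAE).trans_lt hEfin).ne (ENNReal.ofReal_pos.2 (half_pos hδ0))
  -- `U` need not be measurable; its closure is, and has the same diameter.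
  have hlt : ediam U / 2 < μ (A ∩ closure U) := by
    rw [hμE _ (inter_subset_left.trans hAE)]
    refine lt_of_lt_of_le (ENNReal.div_lt_of_lt_mul' hU) (measure_mono ?_)
    exact inter_subset_inter_right _ subset_closure
  obtain ⟨F, hFA, hF, hFlt⟩ :=
    (hAm.inter isClosed_closure.measurableSet).exists_lt_isCompact_of_ne_top
      (measure_ne_top μ (A ∩ closure U)) hlt
  have hFE : F ⊆ E := hFA.trans (inter_subset_left.trans hAE)
  rw [hμE F hFE] at hFlt
  have hFd : ENNReal.ofReal (diam F) = ediam F := ENNReal.ofReal_toReal hF.isBounded.ediam_ne_top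
  have hFU : ediam F ≤ ediam U :=
    (ediam_mono (hFA.trans inter_subset_right)).trans (ediam_closure U).le
  have hFδ : diam F < δ := by
    have : diam F ≤ δ / 2 := ENNReal.toReal_le_of_le_ofReal (by positivity) (hFU.trans hUδ)
    linarith
  have hFhalf : ediam F / 2 < Measure.hausdorffMeasure 1 F :=
    (ENNReal.div_le_div_right hFU 2).trans_lt hFlt
  have hFpos : 0 < diam F := by
    refine diam_nonneg.lt_of_ne' fun h0 => ?_
    have hs : F.Subsingleton := by
      rw [← ediam_eq_zero_iff, ← hFd, h0, ENNReal.ofReal_zero]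
    have := Measure.nullSingletonClass_hausdorff (EuclideanSpace ℝ (Fin n)) one_pos
    rw [hs.measure_zero] at hFhalf
    exact not_lt_zero hFhalf
  have hball : ∀ x ∈ F, F ⊆ closedBall x (diam F) := fun x hx y hy =>
    dist_le_diam_of_mem hF.isBounded hy hx
  have hgrow : ∀ x ∈ F, ∀ t ∈ Ioo 0 δ,
      Measure.hausdorffMeasure 1 (F ∩ closedBall x t) ≤ ENNReal.ofReal (3 * t) := fun x hx t ht =>
    (measure_mono (inter_subset_inter_left _ hFE)).trans ((hFA hx).1.2.2 t ht)
  obtain ⟨x₀, hx₀⟩ : F.Nonempty := by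
    rw [nonempty_iff_ne_empty]
    rintro rfl
    simp at hFpos
  have hF3 : Measure.hausdorffMeasure 1 F ≤ ENNReal.ofReal (3 * diam F) := by
    simpa [inter_eq_left.2 (hball x₀ hx₀)] using hgrow x₀ hx₀ _ ⟨hFpos, hFδ⟩
  refine ⟨F, hFE, hF, ?_, ?_, fun x hx t ht => ?_⟩
  · calc totalMengerCurvatureSq F ≤ ∫⁻ _ in F, ENNReal.ofReal (η / 3)
          ∂(Measure.hausdorffMeasure 1) := by
          refine setLIntegral_mono' hF.measurableSet fun x hx => ?_
          refine le_trans ?_ (hFA hx).1.2.1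
          rw [hμ, Measure.restrict_restrict measurableSet_closedBall]
          refine lintegral_mono' (Measure.restrict_mono (subset_inter
            ((hball x hx).trans (closedBall_subset_closedBall hFδ.le)) hFE) le_rfl) fun y => ?_
          exact lintegral_mono_set hFE
      _ = ENNReal.ofReal (η / 3) * Measure.hausdorffMeasure 1 F := setLIntegral_const _ _
      _ ≤ ENNReal.ofReal (η / 3) * ENNReal.ofReal (3 * diam F) := by gcongr
      _ = ENNReal.ofReal (η * diam F) := by
          rw [← ENNReal.ofReal_mul (by positivity)]
          congr 1
          ring
  · refine lt_of_le_of_lt ?_ hFhalf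
    have h2 : ediam F / 2 = ENNReal.ofReal (diam F / 2) := by
      rw [ENNReal.ofReal_div_of_pos two_pos, hFd, ENNReal.ofReal_ofNat]
    rw [h2]
    exact ENNReal.ofReal_le_ofReal (by linarith)
  · rcases lt_or_ge t δ with h | h
    · exact hgrow x hx t ⟨ht, h⟩
    · exact (measure_mono inter_subset_left).trans
        (hF3.trans (ENNReal.ofReal_le_ofReal (by linarith)))
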